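/- **Setting.** Let $L^\xi$ be a first-order language with equality, constants $0,1,2$, a relation $\le$, a binary function $\mathrm{Max}$ and, for every natural number $k$, a closed term denoting $k$, interpreted in the standard model $\mathbb N$. A *generic configuration* $\xi=(L^\xi,\Delta_0^\xi,B^\xi,d,G)$ consists of such a language; a set $\Delta_0^\xi$ of formulae all of whose quantifiers are bounded ($\forall v\le t$, $\exists v\le t$ with $t$ a term not containing $v$), closed under negation, containing the sentence $0=1$ and formulae that define the graphs of addition and multiplication in $\mathbb N$; a deduction method $d$ by which every logical consequence of an axiom system is provable from it, for which provability is preserved when axioms are added, and which proves $Z$ from an axiom system whenever it proves $X$, $Y$ and $X\wedge Y\to Z$ from it; a set $B^\xi$ of sentences true in $\mathbb N$ from which $d$ proves every true $\Sigma_1^\xi$ sentence; and an injective numbering $G$ of sentences and of proofs by natural numbers. Here a sentence is $\Pi_1^\xi$ (respectively $\Sigma_1^\xi$) if it has the form $\forall v_1\dots\forall v_k\,\Phi$ (respectively $\exists v_1\dots\exists v_k\,\Phi$) with $k\ge 0$ and $\Phi\in\Delta_0^\xi$. Let $\alpha$ be a set of $L^\xi$-sentences and let $\mathrm{Prf}_{\alpha,d}(t,p)$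 be any $L^\xi$-formula that expresses in $\mathbb N$ that $p$ is the number of a $d$-proof from $\alpha$ of the sentence with number $t$. The *consistency statement* of $\alpha$ is $\forall p\,\neg\mathrm{Prf}_{\alpha,d}(\ulcorner 0=1\urcorner,p)$. Call $\alpha$ *$\xi$-conventional* if $\alpha\supseteq B^\xi$ and $d$ does not prove the consistency statement of $\alpha$ from $\alpha$. Call $(\alpha,d)$ *self-justifying* if $d$ proves the consistency statement of $\alpha$ from $\alpha$ and $d$ does not prove $0=1$ from $\alpha$. A *translation* is a map $T$ (computable or not) that sends each $\Pi_1^\xi$ sentence $\Psi$ to a $\Pi_1^\xi$ sentence $\Psi^T$ such that $\Psi^T$ is true in $\mathbb N$ if and only if $\Psi$ is. **Theorem E.1.** (i) If $\alpha$ is $\xi$-conventional, then $\alpha$ proves (by $d$) every true $\Sigma_1^\xi$ sentence and refutes every false $\Pi_1^\xi$ sentence, and there is no translation $T$ such that $\alpha$ proves the translational reflection principle $$\forall p\,[\,\mathrm{Prf}_{\alpha,d}(\ulcorner\Psi\urcorner,p)\Rightarrow\Psi^T\,]$$ for every $\Pi_1^\xi$ sentence $\Psi$. (ii) Consequently, if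 $\alpha\supseteq B^\xi$, if $d$ does not prove $0=1$ from $\alpha$, and if for some translation $T$ the system $\alpha$ proves this principle for every $\Pi_1^\xi$ sentence $\Psi$, then $(\alpha,d)$ is self-justifying. -/

import Mathlib

open FirstOrder FirstOrder.Language

universe u v w

namespace GenericConfig

/-- The distinguished symbols of an arithmetical language: constants `0`, `1`, `2`, the binary
relation `≤`, the binary operation `Max`, and, for every natural number `k`, a closed term
`numeral k`. (Equality is a logical symbol.) The Standard-M model is an `L`-structure on `ℕ`
in which these symbols have their intended meaning. -/
structure ArithmeticSymbols (L : FirstOrder.Language.{u, v}) [L.Structure ℕ] where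
  zero : L.Functions 0
  one : L.Functions 0
  two : L.Functions 0
  max : L.Functions 2
  le : L.Relations 2
  numeral : ℕ → L.Term Empty
  zero_std : Structure.funMap (M := ℕ) zero ![] = 0
  one_std : Structure.funMap (M := ℕ) one ![] = 1
  two_std : Structure.funMap (M := ℕ) two ![] = 2
  max_std : ∀ x y : ℕ, Structure.funMap (M := ℕ) max ![x, y] = Nat.max x y
  le_std : ∀ x y : ℕ, Structure.RelMap (M := ℕ) le ![x, y] ↔ x ≤ y
  numeral_std : ∀ k : ℕ, (numeral k).realize (Empty.elim : Empty → ℕ) = k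

namespace ArithmeticSymbols

variable {L : FirstOrder.Language.{u, v}} [L.Structure ℕ] (S : ArithmeticSymbols L)

/-- The formula `v ≤ t` where `v` is the new variable number `n` and `t` is a term in the
variables `0, …, n - 1`. -/
def leTerm {n : ℕ} (t : L.Term (Empty ⊕ Fin n)) : L.BoundedFormula Empty (n + 1) :=
  S.le.boundedFormula₂ (Term.var (Sum.inr (Fin.last n)))
    (t.relabel (Sum.map id Fin.castSucc))

/-- The bounded quantifier `∀ v ≤ t, φ`. -/
def ball {n : ℕ} (t : L.Term (Empty ⊕ Fin n)) (φ : L.BoundedFormula Empty (n + 1)) :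
    L.BoundedFormula Empty n :=
  ((S.leTerm t).imp φ).all

/-- The bounded quantifier `∃ v ≤ t, φ`. -/
def bex {n : ℕ} (t : L.Term (Empty ⊕ Fin n)) (φ : L.BoundedFormula Empty (n + 1)) :
    L.BoundedFormula Empty n :=
  (S.leTerm t ⊓ φ).ex

/-- Fully bounded formulae: all quantifiers are bounded. (Other connectives than implication
and falsity are abbreviations.) -/
inductive FullyBounded : ∀ {n : ℕ}, L.BoundedFormula Empty n → Prop
  | falsum {n : ℕ} : FullyBounded (BoundedFormula.falsum : L.BoundedFormula Empty n)
  | equal {n : ℕ} (s t : L.Term (Empty ⊕ Fin n)) : FullyBounded (BoundedFormula.equal s t)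
  | rel {n l : ℕ} (R : L.Relations l) (ts : Fin l → L.Term (Empty ⊕ Fin n)) :
      FullyBounded (BoundedFormula.rel R ts)
  | imp {n : ℕ} {φ ψ : L.BoundedFormula Empty n} :
      FullyBounded φ → FullyBounded ψ → FullyBounded (φ.imp ψ)
  | ball {n : ℕ} (t : L.Term (Empty ⊕ Fin n)) {φ : L.BoundedFormula Empty (n + 1)} :
      FullyBounded φ → FullyBounded (S.ball t φ)
  | bex {n : ℕ} (t : L.Term (Empty ⊕ Fin n)) {φ : L.BoundedFormula Empty (n + 1)} :
      FullyBounded φ → FullyBounded (S.bex t φ)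

/-- The sentence `0 = 1`. -/
def zeroEqOne : L.Sentence :=
  BoundedFormula.equal (Term.func S.zero ![]) (Term.func S.one ![])

/-- The formula `Prf(⌜n⌝, p)` with the single free variable `p` (indexed by `Unit`), obtained from
the formula `prf` in two variables, `0` for the theorem and `1` for the proof. -/
def prfAt (prf : L.Formula (Fin 2)) (n : ℕ) : L.Formula (Empty ⊕ Unit) :=
  BoundedFormula.subst prf
    ![(S.numeral n).relabel Sum.inl, Term.var (Sum.inr ())]

end ArithmeticSymbols

/-- A method of deduction for first-order sentences: `IsProof T φ p` says that `p` is a proof of `φ`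
from the axiom system `T`. Everything that follows logically from `T` has a proof from `T`
(completeness), more axioms do not destroy provability, and a theorem `Z` can be proved whenever
`X`, `Y` and `X ∧ Y → Z` can (whether or not modus ponens is a rule). Every sound and complete
calculus satisfies this; soundness is not demanded. -/
structure DeductionMethod (L : FirstOrder.Language.{u, v}) where
  Proof : Type w
  IsProof : Set L.Sentence → L.Sentence → Proof → Prop
  complete : ∀ (T : L.Theory) (φ : L.Sentence), T ⊨ᵇ φ → ∃ p, IsProof T φ p
  mono : ∀ (T T' : Set L.Sentence) (φ : L.Sentence), T ⊆ T' →
    (∃ p, IsProof T φ p) → ∃ p, IsProof T' φ p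
  indirect : ∀ (T : Set L.Sentence) (X Y Z : L.Sentence),
    (∃ p, IsProof T X p) → (∃ p, IsProof T Y p) →
    (∃ p, IsProof T (BoundedFormula.imp (X ⊓ Y) Z) p) → ∃ p, IsProof T Z p

/-- `T` proves `φ` by the method `d`. -/
def DeductionMethod.Proves {L : FirstOrder.Language.{u, v}} (d : DeductionMethod.{u, v, w} L)
    (T : Set L.Sentence) (φ : L.Sentence) : Prop :=
  ∃ p, d.IsProof T φ p

/-- A Gödel numbering of the sentences and of the proofs. -/
structure GodelNumbering (L : FirstOrder.Language.{u, v}) (P : Type w) where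
  sentence : L.Sentence → ℕ
  proof : P → ℕ
  sentence_injective : Function.Injective sentence
  proof_injective : Function.Injective proof

/-- `Σ₁` sentences over a class `Δ` of formulae: `∃ v₁ … ∃ vₖ Φ` with `Φ` in `Δ`. Here
`Δ k` is the set of the formulae of the class in the variables `v₁, …, vₖ`. -/
def IsSigmaOne {L : FirstOrder.Language.{u, v}} (Δ : ∀ n : ℕ, Set (L.BoundedFormula Empty n))
    (φ : L.Sentence) : Prop :=
  ∃ (k : ℕ) (Φ : L.BoundedFormula Empty k), Φ ∈ Δ k ∧ φ = Φ.exs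

/-- `Π₁` sentences over a class `Δ` of formulae: `∀ v₁ … ∀ vₖ Φ` with `Φ` in `Δ`. -/
def IsPiOne {L : FirstOrder.Language.{u, v}} (Δ : ∀ n : ℕ, Set (L.BoundedFormula Empty n))
    (φ : L.Sentence) : Prop :=
  ∃ (k : ℕ) (Φ : L.BoundedFormula Empty k), Φ ∈ Δ k ∧ φ = Φ.alls

/-- A generic configuration `ξ = (L, Δ₀, B, d, G)`. -/
structure GenericConfiguration (L : FirstOrder.Language.{u, v}) [L.Structure ℕ] where
  symbols : ArithmeticSymbols L
  /-- `Δ₀ n` is the set of the `Δ₀` formulae in the variables `0, …, n - 1`. -/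
  Δ₀ : ∀ n : ℕ, Set (L.BoundedFormula Empty n)
  Δ₀_bounded : ∀ (n : ℕ), ∀ φ ∈ Δ₀ n, symbols.FullyBounded φ
  Δ₀_not : ∀ (n : ℕ), ∀ φ ∈ Δ₀ n, φ.not ∈ Δ₀ n
  Δ₀_zeroEqOne : symbols.zeroEqOne ∈ Δ₀ 0
  Δ₀_add : ∃ φ ∈ Δ₀ 3, ∀ x y z : ℕ,
    φ.Realize (Empty.elim : Empty → ℕ) ![x, y, z] ↔ x + y = z
  Δ₀_mult : ∃ φ ∈ Δ₀ 3, ∀ x y z : ℕ,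
    φ.Realize (Empty.elim : Empty → ℕ) ![x, y, z] ↔ x * y = z
  /-- The method of deduction. -/
  d : DeductionMethod.{u, v, w} L
  /-- The base axiom system. -/
  B : Set L.Sentence
  B_true : ∀ φ ∈ B, ℕ ⊨ φ
  B_sigmaOne_complete : ∀ φ : L.Sentence, IsSigmaOne Δ₀ φ → ℕ ⊨ φ → d.Proves B φ
  /-- The Gödel numbering. -/
  G : GodelNumbering L d.Proof

namespace GenericConfiguration

variable {L : FirstOrder.Language.{u, v}} [L.Structure ℕ] (ξ : GenericConfiguration.{u, v, w} L)

/-- The formula `prf` expresses, in the Standard-M model, that its second argument is (the number of)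
a proof of (the sentence with number) its first argument from `α` by the method of `ξ`, so that it
can serve as the formula `Prf_{α,d}`. -/
def ExpressesProof (α : Set L.Sentence) (prf : L.Formula (Fin 2)) : Prop :=
  ∀ t p : ℕ, prf.Realize ![t, p] ↔
    ∃ (φ : L.Sentence) (q : ξ.d.Proof),
      ξ.G.sentence φ = t ∧ ξ.G.proof q = p ∧ ξ.d.IsProof α φ q

/-- The sentence `∀ p, ¬ Prf(⌜0 = 1⌝, p)`. -/
noncomputable def con (prf : L.Formula (Fin 2)) : L.Sentence :=
  Formula.iAlls Unit (ξ.symbols.prfAt prf (ξ.G.sentence ξ.symbols.zeroEqOne)).not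

/-- The sentence `∀ p, [Prf(⌜Ψ⌝, p) → Θ]`; with `Θ = Ψ^T` this is the translational reflection
principle for `Ψ`. -/
noncomputable def reflection (prf : L.Formula (Fin 2)) (Ψ Θ : L.Sentence) : L.Sentence :=
  Formula.iAlls Unit
    ((ξ.symbols.prfAt prf (ξ.G.sentence Ψ)).imp (Formula.relabel Sum.inl Θ))

/-- `α` (with `prf` as its formula `Prf_{α,d}`) is `ξ`-conventional: it is an extension of the base
axiom system and does not prove its own consistency. -/
def IsConventional (α : Set L.Sentence) (prf : L.Formula (Fin 2)) : Prop :=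
  ¬ ξ.d.Proves α (ξ.con prf) ∧ ξ.B ⊆ α

/-- `(α, d)` is self-justifying: `α` proves its own consistency and is in fact consistent. -/
def IsSelfJustifying (α : Set L.Sentence) (prf : L.Formula (Fin 2)) : Prop :=
  ξ.d.Proves α (ξ.con prf) ∧ ¬ ξ.d.Proves α ξ.symbols.zeroEqOne

/-- `T` maps every `Π₁` sentence to a `Π₁` sentence that is equivalent to it in the Standard-M
model. -/
def IsTranslation (T : L.Sentence → L.Sentence) : Prop :=
  ∀ Ψ : L.Sentence, IsPiOne ξ.Δ₀ Ψ → IsPiOne ξ.Δ₀ (T Ψ) ∧ (ℕ ⊨ T Ψ ↔ ℕ ⊨ Ψ)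

/-- `α` proves the translational reflection principle `∀ p, [Prf(⌜Ψ⌝, p) → Ψ^T]` for all `Π₁`
sentences `Ψ`. -/
def ProvesReflection (α : Set L.Sentence) (prf : L.Formula (Fin 2))
    (T : L.Sentence → L.Sentence) : Prop :=
  ∀ Ψ : L.Sentence, IsPiOne ξ.Δ₀ Ψ → ξ.d.Proves α (ξ.reflection prf Ψ (T Ψ))

end GenericConfiguration

end GenericConfig

namespace GenericConfig

/-! One instance of reflection suffices, the one for `0 = 1`. Its translation `Θ` is a false `Π₁`
sentence, so `¬Θ` is equivalent to a true `Σ₁` sentence and is already provable over `B`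
(`refutes_of_piOne`). Reflection says that a proof of `0 = 1` would yield `Θ`; with `¬Θ` this gives
the consistency statement (`realize_con_of_reflection`). Both halves of the theorem read off this
conclusion, and no diagonal argument is involved. -/

/-- Whatever two provable sentences entail in every nonempty structure is provable. -/
theorem DeductionMethod.Proves.of_entails {L : FirstOrder.Language.{u, v}}
    {d : DeductionMethod.{u, v, w} L} {A : Set L.Sentence} {X Y Z : L.Sentence}
    (hX : d.Proves A X) (hY : d.Proves A Y)
    (h : ∀ (M : Type (max u v)) [L.Structure M] [Nonempty M], M ⊨ X → M ⊨ Y → M ⊨ Z) :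
    d.Proves A Z := by
  -- Completeness makes the valid sentence `X ∧ Y → Z` provable; `indirect` then detaches `Z`, so
  -- neither soundness nor modus ponens is needed.
  refine d.indirect A X Y Z hX hY (d.complete A _ ?_)
  rw [Theory.models_sentence_iff]
  intro M
  have hM := h M
  simp only [Sentence.Realize, Formula.Realize, BoundedFormula.realize_imp,
    BoundedFormula.realize_inf, and_imp] at hM ⊢
  exact hM

theorem realize_exs_not_iff {L : FirstOrder.Language.{u, v}} {M : Type*} [L.Structure M] {k : ℕ}
    (Φ : L.BoundedFormula Empty k) :
    M ⊨ (Φ.not.exs : L.Sentence) ↔ ¬ M ⊨ (Φ.alls : L.Sentence) := by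
  simp only [Sentence.Realize, BoundedFormula.realize_exs, BoundedFormula.realize_alls,
    BoundedFormula.realize_not, not_forall]

namespace GenericConfiguration

variable {L : FirstOrder.Language.{u, v}} [L.Structure ℕ]
  (ξ : GenericConfiguration.{u, v, w} L)

theorem isPiOne_zeroEqOne : IsPiOne ξ.Δ₀ ξ.symbols.zeroEqOne :=
  ⟨0, ξ.symbols.zeroEqOne, ξ.Δ₀_zeroEqOne, rfl⟩

theorem not_realize_zeroEqOne : ¬ ℕ ⊨ ξ.symbols.zeroEqOne := by
  intro h
  have h' : Structure.funMap (M := ℕ) ξ.symbols.zero _ =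
      Structure.funMap (M := ℕ) ξ.symbols.one _ := h
  -- The realized argument tuple is a function on `Fin 0` that is not syntactically `![]`.
  rw [Matrix.empty_eq (fun i => _), ξ.symbols.zero_std, ξ.symbols.one_std] at h'
  exact zero_ne_one h'

variable {ξ} {α : Set L.Sentence}

theorem proves_of_sigmaOne (hB : ξ.B ⊆ α) {φ : L.Sentence} (hφ : IsSigmaOne ξ.Δ₀ φ)
    (h : ℕ ⊨ φ) : ξ.d.Proves α φ :=
  ξ.d.mono _ _ _ hB (ξ.B_sigmaOne_complete φ hφ h)

/-- Since `Δ₀` is closed under negation, a counterexample to `∀ v Φ` makes `∃ v ¬Φ` a true `Σ₁`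
sentence. -/
theorem refutes_of_piOne (hB : ξ.B ⊆ α) {φ : L.Sentence} (hφ : IsPiOne ξ.Δ₀ φ)
    (h : ¬ ℕ ⊨ φ) : ξ.d.Proves α (Formula.not φ) := by
  obtain ⟨k, Φ, hΦ, rfl⟩ := hφ
  have hex : ξ.d.Proves α Φ.not.exs :=
    proves_of_sigmaOne hB ⟨k, Φ.not, ξ.Δ₀_not k Φ hΦ, rfl⟩ ((realize_exs_not_iff Φ).2 h)
  -- Only one premise is needed, so it fills both places.
  refine hex.of_entails hex fun M _ _ hM _ => ?_
  rw [Sentence.realize_not]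
  exact (realize_exs_not_iff Φ).1 hM

/-- Contraposition inside the quantifier over `p`. It holds in every structure, nonstandard ones
included, as provability by completeness requires. -/
theorem realize_con_of_reflection (prf : L.Formula (Fin 2)) (Θ : L.Sentence) {M : Type*}
    [L.Structure M] (hr : M ⊨ ξ.reflection prf ξ.symbols.zeroEqOne Θ)
    (hΘ : M ⊨ (Formula.not Θ : L.Sentence)) : M ⊨ ξ.con prf := by
  rw [Sentence.realize_not] at hΘ
  simp only [reflection, con, Sentence.Realize, Formula.realize_iAlls, Formula.realize_imp,
    Formula.realize_not, Formula.realize_relabel] at hr hΘ ⊢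
  refine fun i hi => hΘ ?_
  -- The two valuations of `Θ` agree because their domain is `Empty`.
  convert hr i hi

theorem proves_con_of_provesReflection (hB : ξ.B ⊆ α) {prf : L.Formula (Fin 2)}
    {T : L.Sentence → L.Sentence} (hT : ξ.IsTranslation T)
    (hr : ξ.ProvesReflection α prf T) : ξ.d.Proves α (ξ.con prf) := by
  obtain ⟨hpi, htrue⟩ := hT _ ξ.isPiOne_zeroEqOne
  -- The translation of `0 = 1` may be any `Π₁` sentence, but it inherits the falsity of `0 = 1` in
  -- `ℕ`.
  have hnot := refutes_of_piOne hB hpi fun h => ξ.not_realize_zeroEqOne (htrue.1 h)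
  exact (hr _ ξ.isPiOne_zeroEqOne).of_entails hnot fun M _ _ =>
    realize_con_of_reflection prf _

end GenericConfiguration

end GenericConfig

theorem theoremE1 {L : FirstOrder.Language.{u, v}} [L.Structure ℕ]
    (ξ : GenericConfig.GenericConfiguration.{u, v, w} L) (α : Set L.Sentence)
    (prf : L.Formula (Fin 2)) (hprf : ξ.ExpressesProof α prf) :
    (ξ.IsConventional α prf →
      (∀ φ : L.Sentence, GenericConfig.IsSigmaOne ξ.Δ₀ φ → ℕ ⊨ φ → ξ.d.Proves α φ) ∧
      (∀ φ : L.Sentence, GenericConfig.IsPiOne ξ.Δ₀ φ → ¬ ℕ ⊨ φ →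
        ξ.d.Proves α (FirstOrder.Language.Formula.not φ)) ∧
      ¬ ∃ T : L.Sentence → L.Sentence, ξ.IsTranslation T ∧ ξ.ProvesReflection α prf T) ∧
    (ξ.B ⊆ α → ¬ ξ.d.Proves α ξ.symbols.zeroEqOne →
      (∃ T : L.Sentence → L.Sentence, ξ.IsTranslation T ∧ ξ.ProvesReflection α prf T) →
      ξ.IsSelfJustifying α prf) := by
  refine ⟨fun ⟨hcon, hB⟩ => ⟨fun φ hφ h => ?_, fun φ hφ h => ?_, fun ⟨T, hT, hr⟩ => hcon ?_⟩,
    fun hB hcons ⟨T, hT, hr⟩ => ⟨?_, hcons⟩⟩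
  · exact GenericConfig.GenericConfiguration.proves_of_sigmaOne hB hφ h
  · exact GenericConfig.GenericConfiguration.refutes_of_piOne hB hφ h
  · exact GenericConfig.GenericConfiguration.proves_con_of_provesReflection hB hT hr
  · exact GenericConfig.GenericConfiguration.proves_con_of_provesReflection hB hT hr
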